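/- Let $G$ be a finitely generated group and let $\mu$ be a probability measure on $G$, not necessarily symmetric, whose support generates $G$ as a semigroup. Let $S\subset G$ be a finite generating set with $S^{-1}=S$, and let $\rho(s)=\min\{n\ge 0 : s\in S^n\}$ be the associated word-norm, where $S^0=\{e\}$ and, for $n\ge 1$, $S^n$ is the set of products of $n$ elements of $S$. Assume that $\rho$ is $\mu$-integrable, i.e. $\sum_{s\in G}\rho(s)\,\mu(s)<\infty$. Let $\check\mu(s)=\mu(s^{-1})$ be the adjoint probability measure. For a probability measure $\nu$ on $G$, say that $(G,\nu)$ is Liouville if every bounded function $u:G\to\mathbb{R}$ satisfying $\sum_{s\in G}u(gs)\,\nu(s)=u(g)$ for all $g\in G$ is constant. Then $(G,\mu)$ is Liouville if and only if $(G,\check\mu)$ is Liouville. -/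

import Mathlib

open scoped Pointwise

noncomputable section

namespace MeasuredGroup

variable {G : Type*} [Group G]

/-- `(G, μ)` is a measured group: `G` is countable and the support of the probability `μ`
generates `G` as a semigroup. -/
structure IsMeasuredGroup (μ : PMF G) : Prop where
  countable : Countable G
  closure_support : Subsemigroup.closure μ.support = ⊤

/-- The adjoint probability `s ↦ μ s⁻¹`. -/
def adjoint (μ : PMF G) : PMF G :=
  ⟨fun s => μ s⁻¹, (Equiv.inv G).hasSum_iff.mpr μ.2⟩

/-- `∑ₛ u (g s) μ(s) = u g` for all `g`, the series being absolutely convergent. -/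
def IsHarmonic (μ : PMF G) (u : G → ℝ) : Prop :=
  ∀ g : G, HasSum (fun s : G => u (g * s) * (μ s).toReal) (u g)

/-- Every bounded harmonic function is constant. -/
def IsLiouville (μ : PMF G) : Prop :=
  ∀ u : G → ℝ, (∃ C : ℝ, ∀ g, |u g| ≤ C) → IsHarmonic μ u → ∃ c : ℝ, ∀ g, u g = c

/-- A finite symmetric generating set of `G`; its existence means that `G` is finitely generated. -/
structure IsFiniteSymmGenerating (S : Set G) : Prop where
  finite : S.Finite
  inv_eq : S⁻¹ = S
  closure_eq : Subgroup.closure S = ⊤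

/-- The word-norm: the least `n ≥ 0` such that `s` is a product of `n` elements of `S`
(so the norm of the identity is `0`). -/
def wordNorm (S : Set G) (s : G) : ℕ :=
  sInf {n : ℕ | s ∈ S ^ n}

end MeasuredGroup

end

open scoped Pointwise

noncomputable section

namespace MeasuredGroup

variable {G : Type*} [Group G]

open Filter Topology

/-! The proof is an entropy criterion for the Liouville property. Let p = (δ₁ + μ)/2, which has the
same harmonic functions as μ, and let X and Yₙ be independent with laws p and p^{*n}.

Liouville means that the first step is asymptotically forgotten: ‖s·p^{*n} − p^{*(n+1)}‖₁ → 0 for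
each s in the support of p (`tendsto_invDefect_of_isLiouville`, `isLiouville_of_tendsto_invDefect`).
This says that X and XYₙ are asymptotically independent. When p has finite entropy, it is equivalent
to H(X | XYₙ) → H(X), by strict concavity of −t log t (`tendsto_condEntropyAt_forall_iff`).

The chain rule `entropy_add_entropy` gives H(X | XYₙ) = H(p) + H(p^{*n}) − H(p^{*(n+1)}). Inversion
preserves entropy and carries p^{*n} to the n-th power of the adjoint of p, so these numbers are the
same for p and its adjoint (`tsum_condEntropyAt_adjoint`). Hence one is Liouville exactly when the
other is.

The first moment serves only to make the entropy finite. Laziness removes periodicity: it forces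
‖Pⁿ⁺¹ − Pⁿ‖ → 0 for the Markov operator P of p. -/

/-! ### Convolution of probabilities -/

/-- The convolution of two probabilities on a group. -/
def conv (μ ν : PMF G) : PMF G :=
  μ.bind fun a => ν.bind fun b => PMF.pure (a * b)

/-- Convolution powers. -/
def convPow (μ : PMF G) : ℕ → PMF G
  | 0 => PMF.pure 1
  | n + 1 => conv μ (convPow μ n)

lemma conv_apply (μ ν : PMF G) (g : G) : conv μ ν g = ∑' a, μ a * ν (a⁻¹ * g) := by
  unfold conv
  rw [PMF.bind_apply]
  refine tsum_congr fun a => ?_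
  congr 1
  rw [PMF.bind_apply, tsum_eq_single (a⁻¹ * g)]
  · simp
  · intro b hb
    rw [PMF.pure_apply, if_neg, mul_zero]
    rintro rfl
    simp at hb

lemma conv_assoc (μ ν ξ : PMF G) : conv (conv μ ν) ξ = conv μ (conv ν ξ) := by
  simp only [conv, PMF.bind_bind, PMF.pure_bind, mul_assoc]

lemma conv_pure_one (μ : PMF G) : conv μ (PMF.pure 1) = μ := by
  simp only [conv, PMF.pure_bind, mul_one, PMF.bind_pure]

lemma pure_one_conv (μ : PMF G) : conv (PMF.pure 1) μ = μ := by
  simp only [conv, PMF.pure_bind, one_mul, PMF.bind_pure]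

lemma conv_convPow_comm (μ : PMF G) (n : ℕ) :
    conv μ (convPow μ n) = conv (convPow μ n) μ := by
  induction n with
  | zero => simp only [convPow, conv_pure_one, pure_one_conv]
  | succ n ih => rw [convPow, conv_assoc, ← ih]

lemma adjoint_apply (μ : PMF G) (s : G) : adjoint μ s = μ s⁻¹ := rfl

lemma adjoint_eq_bind (μ : PMF G) : adjoint μ = μ.bind fun a => PMF.pure a⁻¹ := by
  ext g
  rw [PMF.bind_apply, tsum_eq_single g⁻¹]
  · simp [adjoint_apply]
  · intro b hb
    rw [PMF.pure_apply, if_neg, mul_zero]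
    rintro rfl
    simp at hb

lemma adjoint_adjoint (μ : PMF G) : adjoint (adjoint μ) = μ := by
  ext g
  simp [adjoint_apply]

lemma adjoint_conv (μ ν : PMF G) : adjoint (conv μ ν) = conv (adjoint ν) (adjoint μ) := by
  simp only [adjoint_eq_bind, conv, PMF.bind_bind, PMF.pure_bind, mul_inv_rev]
  exact PMF.bind_comm _ _ _

/-- Inversion reverses the order of convolution, which is harmless because the powers of a single
measure commute. -/
lemma convPow_adjoint (μ : PMF G) (n : ℕ) :
    convPow (adjoint μ) n = adjoint (convPow μ n) := by
  induction n with
  | zero => simp only [convPow, adjoint_eq_bind, PMF.pure_bind, inv_one]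
  | succ n ih => rw [convPow, ih, ← adjoint_conv, convPow, conv_convPow_comm]

/-! ### Real-valued masses -/

lemma summable_mass {α : Type*} (μ : PMF α) : Summable fun s => (μ s).toReal :=
  ENNReal.summable_toReal μ.tsum_coe_ne_top

lemma tsum_mass {α : Type*} (μ : PMF α) : ∑' s, (μ s).toReal = 1 := by
  rw [← ENNReal.tsum_toReal_eq fun s => μ.apply_ne_top s, μ.tsum_coe, ENNReal.toReal_one]

lemma mass_le_one {α : Type*} (μ : PMF α) (s : α) : (μ s).toReal ≤ 1 :=
  ENNReal.toReal_le_of_le_ofReal zero_le_one (by simpa using μ.coe_le_one s)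

lemma summable_bdd_mul_mass {α : Type*} (μ : PMF α) {f : α → ℝ} {C : ℝ} (hf : ∀ s, |f s| ≤ C) :
    Summable fun s => f s * (μ s).toReal := by
  refine Summable.of_norm_bounded ((summable_mass μ).mul_left C) fun s => ?_
  rw [norm_mul, Real.norm_eq_abs, Real.norm_of_nonneg ENNReal.toReal_nonneg]
  exact mul_le_mul_of_nonneg_right (hf s) ENNReal.toReal_nonneg

lemma abs_tsum_bdd_mul_mass_le {α : Type*} (μ : PMF α) {f : α → ℝ} {C : ℝ}
    (hf : ∀ s, |f s| ≤ C) : |∑' s, f s * (μ s).toReal| ≤ C := by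
  have h : HasSum (fun s => C * (μ s).toReal) C := by
    have h := ((summable_mass μ).mul_left C).hasSum
    rwa [tsum_mul_left, tsum_mass, mul_one] at h
  refine tsum_of_norm_bounded (f := fun s => f s * (μ s).toReal) h fun s => ?_
  rw [norm_mul, Real.norm_eq_abs, Real.norm_of_nonneg ENNReal.toReal_nonneg]
  exact mul_le_mul_of_nonneg_right (hf s) ENNReal.toReal_nonneg

lemma mass_conv (μ ν : PMF G) (g : G) :
    (conv μ ν g).toReal = ∑' a, (μ a).toReal * (ν (a⁻¹ * g)).toReal := by
  rw [conv_apply, ENNReal.tsum_toReal_eq]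
  · simp
  · exact fun a => ENNReal.mul_ne_top (μ.apply_ne_top a) (ν.apply_ne_top _)

lemma tsum_mul_mass_conv (μ ν : PMF G) {f : G → ℝ} {C : ℝ} (hf : ∀ g, |f g| ≤ C) :
    ∑' g, f g * (conv μ ν g).toReal =
      ∑' a, (∑' b, f (a * b) * (ν b).toReal) * (μ a).toReal := by
  let W : G × G → ℝ := fun x => f (x.1 * x.2) * ((μ x.1).toReal * (ν x.2).toReal)
  have hW : Summable W := by
    refine Summable.of_norm_bounded (((summable_mass μ).mul_of_nonneg (summable_mass ν)
      (fun _ => ENNReal.toReal_nonneg) (fun _ => ENNReal.toReal_nonneg)).mul_left C) fun x => ?_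
    rw [norm_mul, Real.norm_eq_abs, Real.norm_of_nonneg (by positivity)]
    exact mul_le_mul_of_nonneg_right (hf _) (by positivity)
  -- Reindex pairs of factors (a, b) by (g, a), where g = ab is the product.
  let e : G × G ≃ G × G :=
    { toFun := fun x => (x.2, x.2⁻¹ * x.1)
      invFun := fun x => (x.1 * x.2, x.1)
      left_inv := fun x => by simp
      right_inv := fun x => by simp }
  have h1 : ∑' x, W x = ∑' a, (∑' b, f (a * b) * (ν b).toReal) * (μ a).toReal := by
    rw [hW.tsum_prod]
    refine tsum_congr fun a => ?_
    rw [← tsum_mul_right]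
    exact tsum_congr fun b => by simp only [W]; ring
  have h2 : ∑' x, W x = ∑' g, f g * (conv μ ν g).toReal := by
    rw [← e.tsum_eq W, ((e.summable_iff (f := W)).2 hW).tsum_prod (f := fun x => W (e x))]
    refine tsum_congr fun g => ?_
    rw [mass_conv, ← tsum_mul_left]
    exact tsum_congr fun a => by simp [W, e]
  rw [← h2, h1]

/-! ### The lazy version of a probability -/

/-- The lazy version `(δ₁ + μ) / 2` of `μ`. -/
def lazy (μ : PMF G) : PMF G :=
  ⟨fun s => 2⁻¹ * PMF.pure 1 s + 2⁻¹ * μ s, by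
    have h : HasSum (fun s => 2⁻¹ * (PMF.pure (1 : G)) s + 2⁻¹ * μ s) (2⁻¹ * 1 + 2⁻¹ * 1) := by
      rw [ENNReal.summable.hasSum_iff, ENNReal.tsum_add, ENNReal.tsum_mul_left,
        ENNReal.tsum_mul_left, PMF.tsum_coe, PMF.tsum_coe]
    simpa [ENNReal.inv_two_add_inv_two] using h⟩

lemma lazy_apply (μ : PMF G) (s : G) : lazy μ s = 2⁻¹ * PMF.pure 1 s + 2⁻¹ * μ s := rfl

lemma mass_lazy (μ : PMF G) (s : G) :
    (lazy μ s).toReal = 2⁻¹ * (PMF.pure (1 : G) s).toReal + 2⁻¹ * (μ s).toReal := by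
  rw [lazy_apply, ENNReal.toReal_add]
  · simp only [ENNReal.toReal_mul, ENNReal.toReal_inv, ENNReal.toReal_ofNat]
  · exact ENNReal.mul_ne_top (by simp) (PMF.apply_ne_top _ _)
  · exact ENNReal.mul_ne_top (by simp) (PMF.apply_ne_top _ _)

lemma adjoint_lazy (μ : PMF G) : adjoint (lazy μ) = lazy (adjoint μ) := by
  ext s
  by_cases hs : s = 1 <;> simp [adjoint_apply, lazy_apply, PMF.pure_apply, hs]

lemma hasSum_mul_mass_pure (v : G → ℝ) :
    HasSum (fun s => v s * (PMF.pure (1 : G) s).toReal) (v 1) := by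
  convert hasSum_single (1 : G) (f := fun s => v s * (PMF.pure (1 : G) s).toReal) ?_ using 1
  · simp
  · intro s hs
    simp [PMF.pure_apply, hs]

lemma isHarmonic_lazy_iff (μ : PMF G) (u : G → ℝ) : IsHarmonic (lazy μ) u ↔ IsHarmonic μ u := by
  refine forall_congr' fun g => ?_
  have h0 := hasSum_mul_mass_pure fun s => u (g * s)
  simp only [mul_one] at h0
  constructor
  · intro h
    have h1 := (h.mul_left 2).sub h0
    rw [two_mul, add_sub_cancel_right] at h1
    refine h1.congr_fun fun s => ?_
    rw [mass_lazy]
    ring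
  · intro h
    have h1 := (h0.mul_left 2⁻¹).add (h.mul_left 2⁻¹)
    rw [← add_mul, show (2⁻¹ + 2⁻¹ : ℝ) = 1 by norm_num, one_mul] at h1
    refine h1.congr_fun fun s => ?_
    rw [mass_lazy]
    ring

lemma isLiouville_lazy_iff (μ : PMF G) : IsLiouville (lazy μ) ↔ IsLiouville μ := by
  simp only [IsLiouville, isHarmonic_lazy_iff]

lemma mem_support_lazy {μ : PMF G} {s : G} (hs : s ∈ μ.support) : s ∈ (lazy μ).support := by
  rw [PMF.mem_support_iff] at hs ⊢
  simp [lazy_apply, hs]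

/-! ### Powers of averages with the identity -/

lemma choose_succ_le_of_half_le {m k : ℕ} (h : m ≤ k) :
    (2 * m).choose (k + 1) ≤ (2 * m).choose k := by
  refine Nat.le_of_mul_le_mul_right ?_ (Nat.succ_pos k)
  rw [Nat.succ_eq_add_one, Nat.choose_succ_right_eq]
  exact Nat.mul_le_mul_left _ (by omega)

/-- A binomial row is unimodal, so its variation telescopes: it climbs from 1 to the central
coefficient, then descends to 0, the value just past the end of the row. -/
lemma sum_abs_choose_sub_le (m : ℕ) :
    ∑ k ∈ Finset.range (2 * m + 1),
      |((2 * m).choose (k + 1) : ℝ) - (2 * m).choose k| ≤ 2 * m.centralBinom - 1 := by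
  have hm : 2 * m + 1 = m + (m + 1) := by omega
  rw [hm, Finset.sum_range_add]
  have h1 : ∑ k ∈ Finset.range m, |((2 * m).choose (k + 1) : ℝ) - (2 * m).choose k|
      = m.centralBinom - 1 := by
    rw [Finset.sum_congr rfl (g := fun k => ((2 * m).choose (k + 1) : ℝ) - (2 * m).choose k),
      Finset.sum_range_sub (fun k => ((2 * m).choose k : ℝ))]
    · simp [Nat.centralBinom]
    · intro k hk
      rw [Finset.mem_range] at hk
      refine abs_of_nonneg (sub_nonneg.2 ?_)
      exact_mod_cast Nat.choose_le_succ_of_lt_half_left (by omega)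
  have h2 : ∑ k ∈ Finset.range (m + 1),
      |((2 * m).choose (m + k + 1) : ℝ) - (2 * m).choose (m + k)| = m.centralBinom := by
    rw [Finset.sum_congr rfl
      (g := fun k => ((2 * m).choose (m + k) : ℝ) - (2 * m).choose (m + (k + 1))),
      Finset.sum_range_sub' (fun k => ((2 * m).choose (m + k) : ℝ))]
    · rw [Nat.choose_eq_zero_of_lt (show 2 * m < m + (m + 1) by omega)]
      simp [Nat.centralBinom]
    · intro k _
      rw [abs_sub_comm]
      refine abs_of_nonneg (sub_nonneg.2 ?_)
      exact_mod_cast choose_succ_le_of_half_le (by omega)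
  rw [h1, h2]
  linarith

/-- An integer form of C(2m, m)/4^m ≤ 1/√(2m+1); the factor 2m+1 lets the induction close through
(2m+1)(2m+3) ≤ 4(m+1)². -/
lemma centralBinom_sq_le (m : ℕ) : (2 * m + 1) * m.centralBinom ^ 2 ≤ 16 ^ m := by
  induction m with
  | zero => simp
  | succ m ih =>
    have h := Nat.succ_mul_centralBinom_succ m
    refine Nat.le_of_mul_le_mul_left ?_ (show 0 < (m + 1) ^ 2 by positivity)
    calc (m + 1) ^ 2 * ((2 * (m + 1) + 1) * (m + 1).centralBinom ^ 2)
        = (2 * m + 3) * ((m + 1) * (m + 1).centralBinom) ^ 2 := by ring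
      _ = 4 * ((2 * m + 3) * (2 * m + 1)) * ((2 * m + 1) * m.centralBinom ^ 2) := by
          rw [h]; ring
      _ ≤ 4 * (4 * (m + 1) ^ 2) * 16 ^ m :=
          Nat.mul_le_mul (Nat.mul_le_mul_left _ (by nlinarith)) ih
      _ = (m + 1) ^ 2 * 16 ^ (m + 1) := by ring

lemma tendsto_centralBinom_div :
    Tendsto (fun m : ℕ => (m.centralBinom : ℝ) / 4 ^ m) atTop (𝓝 0) := by
  have h1 : Tendsto (fun m : ℕ => Real.sqrt (1 / ((m : ℝ) + 1))) atTop (𝓝 0) := by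
    have h := (Real.continuous_sqrt.tendsto 0).comp
      (tendsto_one_div_add_atTop_nhds_zero_nat (𝕜 := ℝ))
    rwa [Real.sqrt_zero] at h
  refine squeeze_zero (fun m => by positivity) (fun m => ?_) h1
  refine Real.le_sqrt_of_sq_le ?_
  have h := centralBinom_sq_le m
  have h' : (2 * (m : ℝ) + 1) * (m.centralBinom : ℝ) ^ 2 ≤ 16 ^ m := by exact_mod_cast h
  rw [div_pow, ← pow_mul, mul_comm m 2, pow_mul, div_le_div_iff₀ (by positivity) (by positivity)]
  norm_num
  nlinarith [sq_nonneg (m.centralBinom : ℝ), Nat.cast_nonneg (α := ℝ) m,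
    mul_nonneg (Nat.cast_nonneg (α := ℝ) m) (sq_nonneg (m.centralBinom : ℝ))]

/-- Multiplying by 1 − q replaces the binomial coefficients by their successive differences, so the
norm is at most the total variation of the row, including the initial jump from 0 to 1. -/
lemma norm_one_add_pow_mul_one_sub_le {A : Type*} [NormedRing A] [NormedAlgebra ℝ A]
    (h1 : ‖(1 : A)‖ ≤ 1) {q : A} (hq : ‖q‖ ≤ 1) (m : ℕ) :
    ‖(1 + q) ^ (2 * m) * (1 - q)‖ ≤ 2 * m.centralBinom := by
  have hpow : ∀ k : ℕ, ‖q ^ k‖ ≤ 1 := by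
    intro k
    induction k with
    | zero => simpa using h1
    | succ k ih =>
      rw [pow_succ]
      exact (norm_mul_le _ _).trans (mul_le_one₀ ih (norm_nonneg _) hq)
  have hexp : (1 + q) ^ (2 * m) =
      ∑ k ∈ Finset.range (2 * m + 1), ((2 * m).choose k : ℝ) • q ^ k := by
    rw [add_comm, (Commute.one_right q).add_pow]
    refine Finset.sum_congr rfl fun k _ => ?_
    rw [one_pow, mul_one, Nat.cast_smul_eq_nsmul, nsmul_eq_mul, (Nat.cast_commute _ _).eq]
  have hshift : ∑ k ∈ Finset.range (2 * m + 1), ((2 * m).choose k : ℝ) • q ^ k =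
      1 + ∑ k ∈ Finset.range (2 * m + 1), ((2 * m).choose (k + 1) : ℝ) • q ^ (k + 1) := by
    rw [Finset.sum_range_succ', Finset.sum_range_succ (fun k =>
      ((2 * m).choose (k + 1) : ℝ) • q ^ (k + 1)),
      Nat.choose_eq_zero_of_lt (Nat.lt_succ_self (2 * m))]
    simp [add_comm]
  have key : (1 + q) ^ (2 * m) * (1 - q) = 1 + ∑ k ∈ Finset.range (2 * m + 1),
      (((2 * m).choose (k + 1) : ℝ) - (2 * m).choose k) • q ^ (k + 1) := by
    simp only [sub_smul, Finset.sum_sub_distrib]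
    rw [← add_sub_assoc, ← hshift, mul_sub, mul_one, hexp, Finset.sum_mul]
    simp only [smul_mul_assoc, pow_succ]
  rw [key]
  refine (norm_add_le _ _).trans ?_
  have h2 : ‖∑ k ∈ Finset.range (2 * m + 1),
      (((2 * m).choose (k + 1) : ℝ) - (2 * m).choose k) • q ^ (k + 1)‖
      ≤ 2 * m.centralBinom - 1 := by
    refine (norm_sum_le_of_le _ fun k _ => ?_).trans (sum_abs_choose_sub_le m)
    rw [norm_smul, Real.norm_eq_abs]
    exact mul_le_of_le_one_right (abs_nonneg _) (hpow _)
  linarith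

/-- The norms decrease in n since p is a contraction, so even exponents suffice; there the bound is
C(2m, m)/4^m. -/
lemma tendsto_norm_pow_succ_sub_pow {A : Type*} [NormedRing A] [NormedAlgebra ℝ A]
    (h1 : ‖(1 : A)‖ ≤ 1) {q : A} (hq : ‖q‖ ≤ 1) :
    Tendsto (fun n : ℕ => ‖((2⁻¹ : ℝ) • (1 + q)) ^ (n + 1) - ((2⁻¹ : ℝ) • (1 + q)) ^ n‖)
      atTop (𝓝 0) := by
  set p : A := (2⁻¹ : ℝ) • (1 + q) with hp
  have hpn : ‖p‖ ≤ 1 := by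
    rw [hp, norm_smul, Real.norm_of_nonneg (by norm_num)]
    have := norm_add_le (1 : A) q
    linarith
  have hanti : Antitone fun n : ℕ => ‖p ^ (n + 1) - p ^ n‖ := by
    refine antitone_nat_of_succ_le fun n => ?_
    rw [show p ^ (n + 1 + 1) - p ^ (n + 1) = p * (p ^ (n + 1) - p ^ n) by
      rw [mul_sub, ← pow_succ', ← pow_succ']]
    exact (norm_mul_le _ _).trans (mul_le_of_le_one_left (norm_nonneg _) hpn)
  have heven : ∀ m : ℕ, ‖p ^ (2 * m + 1) - p ^ (2 * m)‖ ≤ m.centralBinom / 4 ^ m := by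
    intro m
    have h2 : p - 1 = (-2⁻¹ : ℝ) • (1 - q) := by
      rw [hp]
      module
    have h3 : p ^ (2 * m + 1) - p ^ (2 * m) =
        ((4 ^ m : ℝ)⁻¹ * -2⁻¹) • ((1 + q) ^ (2 * m) * (1 - q)) := by
      rw [pow_succ, ← mul_sub_one, h2, hp, smul_pow, smul_mul_smul_comm]
      congr 2
      rw [pow_mul, ← inv_pow]
      norm_num
    rw [h3, norm_smul, Real.norm_eq_abs, abs_mul, abs_of_pos (by positivity : (0 : ℝ) < (4 ^ m)⁻¹)]
    have h4 := norm_one_add_pow_mul_one_sub_le h1 hq m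
    have h5 : |(-2⁻¹ : ℝ)| = 2⁻¹ := by rw [abs_neg, abs_of_pos (by norm_num)]
    rw [h5, div_eq_inv_mul, mul_assoc]
    exact mul_le_mul_of_nonneg_left (by linarith) (by positivity)
  have hdiv : Tendsto (fun n : ℕ => n / 2) atTop atTop :=
    Nat.tendsto_div_const_atTop (by norm_num)
  refine squeeze_zero (fun n => norm_nonneg _) (fun n => ?_) (tendsto_centralBinom_div.comp hdiv)
  exact (hanti (Nat.mul_div_le n 2)).trans (heven _)

/-! ### The Markov operator on bounded functions -/

section Operator

variable [TopologicalSpace G] [DiscreteTopology G]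

open scoped BoundedContinuousFunction

/-- The Markov operator `f ↦ (g ↦ ∑ₛ f (g s) μ(s))` on bounded functions. -/
def markov (μ : PMF G) : (G →ᵇ ℝ) →L[ℝ] (G →ᵇ ℝ) :=
  LinearMap.mkContinuous
    { toFun := fun f => BoundedContinuousFunction.ofNormedAddCommGroupDiscrete
        (fun g => ∑' s, f (g * s) * (μ s).toReal) ‖f‖
        fun g => abs_tsum_bdd_mul_mass_le μ fun s => f.norm_coe_le_norm (g * s)
      map_add' := fun f₁ f₂ => by
        ext g
        have h₁ := summable_bdd_mul_mass μ fun s => f₁.norm_coe_le_norm (g * s)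
        have h₂ := summable_bdd_mul_mass μ fun s => f₂.norm_coe_le_norm (g * s)
        simpa [add_mul] using h₁.tsum_add h₂
      map_smul' := fun c f => by
        ext g
        simp [mul_assoc, tsum_mul_left] }
    1 fun f => by
      rw [one_mul]
      exact (BoundedContinuousFunction.norm_le (norm_nonneg f)).2
        fun g => abs_tsum_bdd_mul_mass_le μ fun s => f.norm_coe_le_norm (g * s)

lemma markov_apply (μ : PMF G) (f : G →ᵇ ℝ) (g : G) :
    markov μ f g = ∑' s, f (g * s) * (μ s).toReal := rfl

lemma norm_markov_le (μ : PMF G) : ‖markov μ‖ ≤ 1 :=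
  LinearMap.mkContinuous_norm_le _ zero_le_one _

lemma markov_conv (μ ν : PMF G) : markov (conv μ ν) = markov μ * markov ν := by
  ext f g
  rw [mul_apply_eq_comp, markov_apply, markov_apply,
    tsum_mul_mass_conv μ ν fun s => f.norm_coe_le_norm (g * s)]
  simp only [markov_apply, mul_assoc]

lemma markov_pure_one : markov (PMF.pure (1 : G)) = 1 := by
  ext f g
  rw [markov_apply, (hasSum_mul_mass_pure fun s => f (g * s)).tsum_eq, mul_one]
  rfl

lemma markov_convPow (μ : PMF G) (n : ℕ) : markov (convPow μ n) = markov μ ^ n := by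
  induction n with
  | zero => rw [convPow, markov_pure_one, pow_zero]
  | succ n ih => rw [convPow, markov_conv, ih, pow_succ']

lemma markov_lazy (μ : PMF G) : markov (lazy μ) = (2⁻¹ : ℝ) • (1 + markov μ) := by
  ext f g
  have h₁ := (hasSum_mul_mass_pure fun s => f (g * s)).mul_left 2⁻¹
  have h₂ := (summable_bdd_mul_mass μ fun s => f.norm_coe_le_norm (g * s)).hasSum.mul_left 2⁻¹
  have h := (h₁.add h₂).tsum_eq
  rw [mul_one] at h
  simp only [smul_apply, add_apply,
    one_apply_eq_self, BoundedContinuousFunction.coe_smul,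
    BoundedContinuousFunction.coe_add, Pi.add_apply, smul_eq_mul, mul_add, markov_apply]
  rw [← h]
  refine tsum_congr fun s => ?_
  rw [mass_lazy]
  ring

lemma tendsto_norm_markov_lazy_pow_sub (μ : PMF G) :
    Tendsto (fun n : ℕ => ‖markov (lazy μ) ^ (n + 1) - markov (lazy μ) ^ n‖) atTop (𝓝 0) := by
  rw [markov_lazy]
  exact tendsto_norm_pow_succ_sub_pow (A := (G →ᵇ ℝ) →L[ℝ] (G →ᵇ ℝ)) (q := markov μ)
    ContinuousLinearMap.norm_id_le (norm_markov_le μ)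

lemma markov_eq_self_of_isHarmonic {μ : PMF G} {f : G →ᵇ ℝ} (hf : IsHarmonic μ f) :
    markov μ f = f := by
  ext g
  exact (hf g).tsum_eq

lemma markov_pow_eq_self_of_isHarmonic {μ : PMF G} {f : G →ᵇ ℝ} (hf : IsHarmonic μ f) (n : ℕ) :
    (markov μ ^ n) f = f := by
  induction n with
  | zero => rfl
  | succ n ih =>
    rw [pow_succ', mul_apply_eq_comp, ih, markov_eq_self_of_isHarmonic hf]

end Operator

/-! ### The Liouville property and asymptotic invariance -/

/-- The `ℓ¹`-distance between the translate `s q` and `p * q`. -/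
def invDefect (p q : PMF G) (s : G) : ℝ :=
  ∑' g, |(q (s⁻¹ * g)).toReal - (conv p q g).toReal|

lemma summable_mass_translate (q : PMF G) (s : G) : Summable fun g => (q (s⁻¹ * g)).toReal :=
  ((Equiv.mulLeft s⁻¹).summable_iff (f := fun g => (q g).toReal)).2 (summable_mass q)

lemma summable_invDefect (p q : PMF G) (s : G) :
    Summable fun g => |(q (s⁻¹ * g)).toReal - (conv p q g).toReal| :=
  ((summable_mass_translate q s).sub (summable_mass _)).abs

lemma tsum_translate (q : PMF G) (f : G → ℝ) (s : G) :
    ∑' g, f g * (q (s⁻¹ * g)).toReal = ∑' g, f (s * g) * (q g).toReal := by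
  rw [← (Equiv.mulLeft s).tsum_eq]
  simp

lemma summable_translate (q : PMF G) {f : G → ℝ} {C : ℝ} (hf : ∀ g, |f g| ≤ C) (s : G) :
    Summable fun g => f g * (q (s⁻¹ * g)).toReal := by
  rw [← (Equiv.mulLeft s).summable_iff]
  simpa [Function.comp_def] using summable_bdd_mul_mass q fun g => hf (s * g)

/-- Testing the signed difference against its own sign fₙ writes the defect as Pⁿfₙ(s) − Pⁿ⁺¹fₙ(1).
Any pointwise limit u of Pⁿfₙ is harmonic, because Pⁿ⁺¹fₙ − Pⁿfₙ → 0 in norm although fₙ varies with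
n. So u is constant and the defect tends to 0. -/
lemma tendsto_invDefect_of_isLiouville (μ : PMF G) (h : IsLiouville (lazy μ)) (s : G) :
    Tendsto (fun n => invDefect (lazy μ) (convPow (lazy μ) n) s) atTop (𝓝 0) := by
  let _ : TopologicalSpace G := ⊥
  have _ : DiscreteTopology G := ⟨rfl⟩
  set P := markov (lazy μ) with hP
  let d : ℕ → G → ℝ := fun n g =>
    (convPow (lazy μ) n (s⁻¹ * g)).toReal - (convPow (lazy μ) (n + 1) g).toReal
  have hsign : ∀ x : ℝ, |((SignType.sign x : SignType) : ℝ)| ≤ 1 := by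
    intro x
    rcases SignType.sign x with _ | _ | _ <;> simp
  let f : ℕ → BoundedContinuousFunction G ℝ := fun n =>
    BoundedContinuousFunction.ofNormedAddCommGroupDiscrete
      (fun g => ((SignType.sign (d n g) : SignType) : ℝ)) 1 fun g => hsign _
  have hf : ∀ n, ‖f n‖ ≤ 1 := fun n =>
    (BoundedContinuousFunction.norm_le zero_le_one).2 fun g => hsign _
  have hPn : ∀ n, ‖P ^ n‖ ≤ 1 := fun n => by
    rw [hP, ← markov_convPow]
    exact norm_markov_le _
  have hPf : ∀ n g, |(P ^ n) (f n) g| ≤ 1 := fun n g =>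
    ((BoundedContinuousFunction.norm_coe_le_norm _ g).trans
      ((P ^ n).le_opNorm (f n))).trans (mul_le_one₀ (hPn n) (norm_nonneg _) (hf n))
  have hdiff : ∀ g, Tendsto (fun n => (P ^ (n + 1)) (f n) g - (P ^ n) (f n) g) atTop (𝓝 0) := by
    intro g
    refine squeeze_zero_norm (fun n => ?_) (tendsto_norm_markov_lazy_pow_sub μ)
    have h1 : (P ^ (n + 1)) (f n) g - (P ^ n) (f n) g = ((P ^ (n + 1) - P ^ n) (f n)) g := by
      simp
    rw [h1]
    exact ((BoundedContinuousFunction.norm_coe_le_norm _ g).trans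
      (ContinuousLinearMap.le_opNorm _ _)).trans (mul_le_of_le_one_right (norm_nonneg _) (hf n))
  have hdef : ∀ n, invDefect (lazy μ) (convPow (lazy μ) n) s =
      (P ^ n) (f n) s - (P ^ (n + 1)) (f n) 1 := by
    intro n
    rw [hP, ← markov_convPow, ← markov_convPow, markov_apply, markov_apply,
      ← tsum_translate (convPow (lazy μ) n) (f n) s]
    simp only [one_mul]
    have hs₁ : Summable fun g => f n g * (convPow (lazy μ) n (s⁻¹ * g)).toReal :=
      summable_translate _ (fun g => hsign (d n g)) s
    have hs₂ : Summable fun g => f n g * (convPow (lazy μ) (n + 1) g).toReal :=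
      summable_bdd_mul_mass _ fun g => hsign (d n g)
    rw [← hs₁.tsum_sub hs₂]
    refine tsum_congr fun g => ?_
    rw [← mul_sub]
    exact (sign_mul_self (d n g)).symm
  -- Along an ultrafilter the bounded values Pⁿfₙ(g) converge for all g at once, with no extraction
  -- of subsequences.
  rw [Filter.tendsto_iff_ultrafilter]
  intro U hU
  have hlim : ∀ g, ∃ x ∈ Set.Icc (-1 : ℝ) 1, Tendsto (fun n => (P ^ n) (f n) g) U (𝓝 x) := by
    intro g
    refine isCompact_Icc.ultrafilter_le_nhds (U.map fun n => (P ^ n) (f n) g) ?_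
    refine tendsto_principal.2 ?_
    exact Filter.Eventually.of_forall fun n => abs_le.1 (hPf n g)
  choose u hu hulim using hlim
  have hub : ∀ g, |u g| ≤ 1 := fun g => abs_le.2 (hu g)
  have hulim' : ∀ g, Tendsto (fun n => (P ^ (n + 1)) (f n) g) U (𝓝 (u g)) := by
    intro g
    simpa using ((hdiff g).mono_left hU).add (hulim g)
  have huharm : IsHarmonic (lazy μ) u := by
    intro g
    have h1 : Tendsto (fun n => ∑' t, (P ^ n) (f n) (g * t) * (lazy μ t).toReal) U
        (𝓝 (∑' t, u (g * t) * (lazy μ t).toReal)) := by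
      refine tendsto_tsum_of_dominated_convergence (summable_mass (lazy μ))
        (fun t => (hulim (g * t)).mul_const _) (Filter.Eventually.of_forall fun n t => ?_)
      rw [norm_mul, Real.norm_of_nonneg ENNReal.toReal_nonneg]
      exact mul_le_of_le_one_left ENNReal.toReal_nonneg (hPf n _)
    have h2 : (fun n => ∑' t, (P ^ n) (f n) (g * t) * (lazy μ t).toReal) =
        fun n => (P ^ (n + 1)) (f n) g := by
      ext n
      rw [pow_succ', mul_apply_eq_comp, ← markov_apply]
    rw [h2] at h1
    have h3 := (summable_bdd_mul_mass (lazy μ) fun t => hub (g * t)).hasSum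
    rwa [tendsto_nhds_unique h1 (hulim' g)] at h3
  obtain ⟨c, hc⟩ := h u ⟨1, hub⟩ huharm
  have hfin := (hulim s).sub (hulim' 1)
  rw [hc, hc, sub_self] at hfin
  simpa only [hdef] using hfin

/-- Expanding u(gs) with n steps and u(g) with n+1 steps bounds their difference by sup|u| times the
defect. Hence u is invariant under right translation by the support, and then by the semigroup it
generates. -/
lemma isLiouville_of_tendsto_invDefect {μ : PMF G} (hμ : Subsemigroup.closure μ.support = ⊤)
    (h : ∀ s ∈ μ.support, Tendsto (fun n => invDefect μ (convPow μ n) s) atTop (𝓝 0)) :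
    IsLiouville μ := by
  let _ : TopologicalSpace G := ⊥
  have _ : DiscreteTopology G := ⟨rfl⟩
  rintro u ⟨C, hC⟩ hu
  let f : BoundedContinuousFunction G ℝ :=
    BoundedContinuousFunction.ofNormedAddCommGroupDiscrete u C hC
  have hpow : ∀ n g, ∑' t, u (g * t) * (convPow μ n t).toReal = u g := by
    intro n g
    have h1 := markov_pow_eq_self_of_isHarmonic (f := f) hu n
    rw [← markov_convPow] at h1
    exact congrArg (fun F : BoundedContinuousFunction G ℝ => F g) h1
  have hstep : ∀ s ∈ μ.support, ∀ g, u (g * s) = u g := by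
    intro s hs g
    have hb : ∀ n, |u (g * s) - u g| ≤ C * invDefect μ (convPow μ n) s := by
      intro n
      rw [← hpow n (g * s), ← hpow (n + 1) g]
      have h1 := tsum_translate (convPow μ n) (fun t => u (g * t)) s
      simp only [mul_assoc] at h1 ⊢
      rw [← h1, ← (summable_translate _ (fun t => hC (g * t)) s).tsum_sub
        (summable_bdd_mul_mass _ fun t => hC (g * t)), invDefect, ← tsum_mul_left]
      refine tsum_of_norm_bounded (E := ℝ) ((summable_invDefect μ _ s).mul_left C).hasSum fun t => ?_
      rw [← mul_sub, norm_mul]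
      exact mul_le_mul_of_nonneg_right (hC _) (norm_nonneg _)
    have hl : |u (g * s) - u g| ≤ 0 := by
      refine ge_of_tendsto' (x := atTop) (f := fun n => C * invDefect μ (convPow μ n) s) ?_ hb
      simpa using (h s hs).const_mul C
    exact sub_eq_zero.1 (abs_nonpos_iff.1 hl)
  refine ⟨u 1, fun s => ?_⟩
  have hs : s ∈ Subsemigroup.closure μ.support := hμ ▸ Subsemigroup.mem_top s
  have hall : ∀ g, u (g * s) = u g := by
    induction hs using Subsemigroup.closure_induction with
    | mem x hx => exact hstep x hx
    | mul x y _ _ hx hy => exact fun g => by rw [← mul_assoc, hy, hx]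
  simpa using hall 1

/-! ### Inequalities for `t ↦ -t log t` -/

/-- Strict concavity made quantitative: the tangent at a lies above the graph by at least (√t −
√a)², and √t + √a ≤ 2 turns this into (t − a)²/4. -/
lemma negMulLog_le_tangent_sub_sq {a t : ℝ} (ha : 0 < a) (ha1 : a ≤ 1) (ht : 0 ≤ t) (ht1 : t ≤ 1) :
    Real.negMulLog t ≤ -t * Real.log a - (t - a) - (t - a) ^ 2 / 4 := by
  rcases ht.eq_or_lt with rfl | ht0
  · simp only [Real.negMulLog_zero]
    nlinarith
  obtain ⟨x, hx, rfl⟩ : ∃ x : ℝ, 0 < x ∧ x ^ 2 = t :=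
    ⟨Real.sqrt t, Real.sqrt_pos.2 ht0, Real.sq_sqrt ht⟩
  obtain ⟨y, hy, rfl⟩ : ∃ y : ℝ, 0 < y ∧ y ^ 2 = a :=
    ⟨Real.sqrt a, Real.sqrt_pos.2 ha, Real.sq_sqrt ha.le⟩
  have hx1 : x ≤ 1 := by nlinarith
  have hy1 : y ≤ 1 := by nlinarith
  have hlog : Real.log y - Real.log x ≤ y / x - 1 := by
    rw [← Real.log_div hy.ne' hx.ne']
    exact Real.log_le_sub_one_of_pos (div_pos hy hx)
  have hmul : x ^ 2 * (Real.log y - Real.log x) ≤ x * y - x ^ 2 := by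
    refine (mul_le_mul_of_nonneg_left hlog (sq_nonneg x)).trans_eq ?_
    field_simp
  have hsq : (x ^ 2 - y ^ 2) ^ 2 ≤ 4 * (x - y) ^ 2 := by
    have h4 : (x + y) ^ 2 ≤ 4 := by nlinarith
    calc (x ^ 2 - y ^ 2) ^ 2 = (x + y) ^ 2 * (x - y) ^ 2 := by ring
      _ ≤ 4 * (x - y) ^ 2 := mul_le_mul_of_nonneg_right h4 (sq_nonneg _)
  rw [Real.negMulLog, Real.log_pow, Real.log_pow]
  push_cast
  nlinarith

/-- A one-sided Lipschitz bound at a. It gives the converse direction: posteriors close to the prior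
lose little entropy. -/
lemma negMulLog_sub_le {a t : ℝ} (ha : 0 < a) (ha1 : a ≤ 1) (ht : 0 ≤ t) (ht1 : t ≤ 1) :
    Real.negMulLog a - (1 - Real.log a) * |t - a| ≤ Real.negMulLog t := by
  have hla : Real.log a ≤ 0 := Real.log_nonpos ha.le ha1
  rcases ht.eq_or_lt with rfl | ht0
  · rw [zero_sub, abs_neg, abs_of_pos ha, Real.negMulLog, Real.negMulLog_zero]
    nlinarith
  rcases le_total t a with h | h
  · have hlog : Real.log t ≤ Real.log a := Real.log_le_log ht0 h
    rw [abs_of_nonpos (sub_nonpos.2 h), Real.negMulLog, Real.negMulLog]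
    nlinarith
  · have hlog : a * (Real.log t - Real.log a) ≤ t - a := by
      rw [← Real.log_div ht0.ne' ha.ne']
      refine (mul_le_mul_of_nonneg_left
        (Real.log_le_sub_one_of_pos (div_pos ht0 ha)) ha.le).trans_eq ?_
      field_simp
    have hlt : Real.log t ≤ 0 := Real.log_nonpos ht ht1
    rw [abs_of_nonneg (sub_nonneg.2 h), Real.negMulLog, Real.negMulLog]
    nlinarith [mul_nonneg (sub_nonneg.2 h) (neg_nonneg.2 hlt),
      mul_nonneg (sub_nonneg.2 h) (neg_nonneg.2 hla)]

lemma negMulLog_le_one {t : ℝ} (ht : 0 ≤ t) (ht1 : t ≤ 1) : Real.negMulLog t ≤ 1 := by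
  have h := negMulLog_le_tangent_sub_sq one_pos le_rfl ht ht1
  rw [Real.log_one] at h
  nlinarith [sq_nonneg (t - 1)]

/-! ### Entropy and conditional entropy -/

/-- The Shannon entropy of a probability. -/
def entropy {α : Type*} (μ : PMF α) : ENNReal :=
  ∑' g, ENNReal.ofReal (Real.negMulLog (μ g).toReal)

/-- The conditional probability that the first factor is `s`, given that the product of two
independent factors with laws `p` and `q` is `g`. -/
def posterior (p q : PMF G) (s g : G) : ℝ :=
  (p s).toReal * (q (s⁻¹ * g)).toReal / (conv p q g).toReal

/-- The contribution of `s` to the conditional entropy of the first factor given the product. -/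
def condEntropyAt (p q : PMF G) (s : G) : ℝ :=
  ∑' g, Real.negMulLog (posterior p q s g) * (conv p q g).toReal

lemma mass_mul_mass_le_mass_conv (p q : PMF G) (s g : G) :
    (p s).toReal * (q (s⁻¹ * g)).toReal ≤ (conv p q g).toReal := by
  rw [← ENNReal.toReal_mul]
  refine ENNReal.toReal_mono (PMF.apply_ne_top _ _) ?_
  rw [conv_apply]
  exact ENNReal.le_tsum s

lemma posterior_mul_mass (p q : PMF G) (s g : G) :
    posterior p q s g * (conv p q g).toReal = (p s).toReal * (q (s⁻¹ * g)).toReal := by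
  refine div_mul_cancel_of_imp fun h => le_antisymm ?_ (by positivity)
  exact h ▸ mass_mul_mass_le_mass_conv p q s g

lemma posterior_nonneg (p q : PMF G) (s g : G) : 0 ≤ posterior p q s g := by
  unfold posterior
  positivity

lemma posterior_le_one (p q : PMF G) (s g : G) : posterior p q s g ≤ 1 :=
  div_le_one_of_le₀ (mass_mul_mass_le_mass_conv p q s g) ENNReal.toReal_nonneg

lemma negMulLog_posterior_nonneg (p q : PMF G) (s g : G) :
    0 ≤ Real.negMulLog (posterior p q s g) :=
  Real.negMulLog_nonneg (posterior_nonneg p q s g) (posterior_le_one p q s g)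

lemma summable_condEntropyAt (p q : PMF G) (s : G) :
    Summable fun g => Real.negMulLog (posterior p q s g) * (conv p q g).toReal :=
  summable_bdd_mul_mass _ (C := 1) fun g => by
    rw [abs_of_nonneg (negMulLog_posterior_nonneg p q s g)]
    exact negMulLog_le_one (posterior_nonneg p q s g) (posterior_le_one p q s g)

lemma condEntropyAt_nonneg (p q : PMF G) (s : G) : 0 ≤ condEntropyAt p q s :=
  tsum_nonneg fun g => mul_nonneg (negMulLog_posterior_nonneg p q s g) ENNReal.toReal_nonneg

lemma hasSum_posterior_mul_mass (p q : PMF G) (s : G) :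
    HasSum (fun g => posterior p q s g * (conv p q g).toReal) (p s).toReal := by
  simp only [posterior_mul_mass]
  have h := (summable_mass_translate q s).hasSum.mul_left (p s).toReal
  have h1 := (Equiv.mulLeft s⁻¹).tsum_eq fun g => (q g).toReal
  rw [Equiv.coe_mulLeft, tsum_mass] at h1
  rwa [h1, mul_one] at h

lemma hasSum_mass {α : Type*} (μ : PMF α) : HasSum (fun s => (μ s).toReal) 1 :=
  tsum_mass μ ▸ (summable_mass μ).hasSum

/-- The posterior averages to the prior p(s), so the linear terms of the tangent integrate out and
the entropy deficit is the mean gap between tangent and graph. -/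
lemma hasSum_tangent_sub_negMulLog (p q : PMF G) (s : G) :
    HasSum (fun g => (-posterior p q s g * Real.log (p s).toReal
        - (posterior p q s g - (p s).toReal) - Real.negMulLog (posterior p q s g))
        * (conv p q g).toReal)
      (Real.negMulLog (p s).toReal - condEntropyAt p q s) := by
  have h1 := hasSum_posterior_mul_mass p q s
  have h := (((h1.mul_right (-Real.log (p s).toReal)).sub h1).add
    ((hasSum_mass (conv p q)).mul_left (p s).toReal)).sub (summable_condEntropyAt p q s).hasSum
  rw [show (p s).toReal * -Real.log (p s).toReal - (p s).toReal + (p s).toReal * 1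
      = Real.negMulLog (p s).toReal by rw [Real.negMulLog]; ring] at h
  exact h.congr_fun fun g => by ring

lemma hasSum_abs_posterior_sub (p q : PMF G) (s : G) :
    HasSum (fun g => |posterior p q s g - (p s).toReal| * (conv p q g).toReal)
      ((p s).toReal * invDefect p q s) := by
  refine ((summable_invDefect p q s).hasSum.mul_left (p s).toReal).congr_fun fun g => ?_
  have h1 : (conv p q g).toReal = |(conv p q g).toReal| := (abs_of_nonneg ENNReal.toReal_nonneg).symm
  have h2 : (p s).toReal = |(p s).toReal| := (abs_of_nonneg ENNReal.toReal_nonneg).symm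
  calc |posterior p q s g - (p s).toReal| * (conv p q g).toReal
      = |posterior p q s g - (p s).toReal| * |(conv p q g).toReal| := by rw [← h1]
    _ = |(p s).toReal| * |(q (s⁻¹ * g)).toReal - (conv p q g).toReal| := by
        rw [← abs_mul, sub_mul, posterior_mul_mass, ← mul_sub, abs_mul]
    _ = _ := by rw [← h2]

lemma mass_pos {α : Type*} {p : PMF α} {s : α} (hs : s ∈ p.support) : 0 < (p s).toReal :=
  ENNReal.toReal_pos ((PMF.mem_support_iff _ _).1 hs) (p.apply_ne_top s)

lemma condEntropyAt_of_notMem {p : PMF G} (q : PMF G) {s : G} (hs : s ∉ p.support) :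
    condEntropyAt p q s = Real.negMulLog (p s).toReal := by
  have h : p s = 0 := by simpa [PMF.mem_support_iff] using hs
  simp [condEntropyAt, posterior, h]

lemma condEntropyAt_le (p q : PMF G) (s : G) :
    condEntropyAt p q s ≤ Real.negMulLog (p s).toReal := by
  by_cases hs : s ∈ p.support
  · refine sub_nonneg.1 ((hasSum_tangent_sub_negMulLog p q s).nonneg fun g => ?_)
    refine mul_nonneg ?_ ENNReal.toReal_nonneg
    have h := negMulLog_le_tangent_sub_sq (mass_pos hs) (mass_le_one p s)
      (posterior_nonneg p q s g) (posterior_le_one p q s g)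
    nlinarith [sq_nonneg (posterior p q s g - (p s).toReal)]
  · exact (condEntropyAt_of_notMem q hs).le

/-- A Pinsker-type bound: |x| ≤ ε + x²/(4ε) takes the place of Cauchy–Schwarz, and the mean of x²/4
is at most the entropy deficit. -/
lemma mass_mul_invDefect_le {p : PMF G} (q : PMF G) {s : G} (hs : s ∈ p.support) {ε : ℝ}
    (hε : 0 < ε) : (p s).toReal * invDefect p q s ≤
      ε + ε⁻¹ * (Real.negMulLog (p s).toReal - condEntropyAt p q s) := by
  have h := ((hasSum_mass (conv p q)).mul_left ε).add
    ((hasSum_tangent_sub_negMulLog p q s).mul_left ε⁻¹)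
  rw [mul_one] at h
  refine hasSum_le (fun g => ?_) (hasSum_abs_posterior_sub p q s) h
  rw [← mul_assoc, ← add_mul]
  refine mul_le_mul_of_nonneg_right ?_ ENNReal.toReal_nonneg
  have h1 := negMulLog_le_tangent_sub_sq (mass_pos hs) (mass_le_one p s)
      (posterior_nonneg p q s g) (posterior_le_one p q s g)
  have h2 : |posterior p q s g - (p s).toReal| ≤
      ε + ε⁻¹ * ((posterior p q s g - (p s).toReal) ^ 2 / 4) := by
    rw [← sq_abs (posterior p q s g - (p s).toReal)]
    have h3 : ε⁻¹ * (2 * ε - |posterior p q s g - (p s).toReal|) ^ 2 =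
      4 * (ε + ε⁻¹ * (|posterior p q s g - (p s).toReal| ^ 2 / 4)
        - |posterior p q s g - (p s).toReal|) := by
      field_simp
      ring
    have h4 : 0 ≤ ε⁻¹ * (2 * ε - |posterior p q s g - (p s).toReal|) ^ 2 := by positivity
    linarith
  refine h2.trans (add_le_add_right (mul_le_mul_of_nonneg_left ?_ (by positivity)) ε)
  linarith

lemma le_condEntropyAt {p : PMF G} (q : PMF G) {s : G} (hs : s ∈ p.support) :
    Real.negMulLog (p s).toReal
      - (1 - Real.log (p s).toReal) * ((p s).toReal * invDefect p q s) ≤ condEntropyAt p q s := by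
  have h := ((hasSum_mass (conv p q)).mul_left (Real.negMulLog (p s).toReal)).sub
    ((hasSum_abs_posterior_sub p q s).mul_left (1 - Real.log (p s).toReal))
  rw [mul_one] at h
  refine hasSum_le (fun g => ?_) h (summable_condEntropyAt p q s).hasSum
  rw [← mul_assoc, ← sub_mul]
  exact mul_le_mul_of_nonneg_right (negMulLog_sub_le (mass_pos hs) (mass_le_one p s)
      (posterior_nonneg p q s g) (posterior_le_one p q s g)) ENNReal.toReal_nonneg

lemma tendsto_condEntropyAt_iff {p : PMF G} (q : ℕ → PMF G) {s : G} (hs : s ∈ p.support) :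
    Tendsto (fun n => condEntropyAt p (q n) s) atTop (𝓝 (Real.negMulLog (p s).toReal)) ↔
      Tendsto (fun n => invDefect p (q n) s) atTop (𝓝 0) := by
  have hp := mass_pos hs
  constructor
  · intro h
    have hD : Tendsto (fun n => Real.negMulLog (p s).toReal - condEntropyAt p (q n) s) atTop
        (𝓝 0) := by simpa using h.const_sub (Real.negMulLog (p s).toReal)
    have hmul : Tendsto (fun n => (p s).toReal * invDefect p (q n) s) atTop (𝓝 0) := by
      have hnn : ∀ n, 0 ≤ (p s).toReal * invDefect p (q n) s := fun n =>
        mul_nonneg hp.le (tsum_nonneg fun g => abs_nonneg _)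
      rw [Metric.tendsto_nhds]
      intro ε hε
      have hε' : Tendsto (fun n => ε / 2 + (ε / 2)⁻¹ *
          (Real.negMulLog (p s).toReal - condEntropyAt p (q n) s)) atTop (𝓝 (ε / 2)) := by
        simpa using (hD.const_mul (ε / 2)⁻¹).const_add (ε / 2)
      filter_upwards [hε'.eventually_lt_const (half_lt_self hε)] with n hn
      rw [Real.dist_0_eq_abs, abs_of_nonneg (hnn n)]
      exact (mass_mul_invDefect_le (q n) hs (half_pos hε)).trans_lt hn
    have h2 := hmul.const_mul (p s).toReal⁻¹
    simpa only [inv_mul_cancel_left₀ hp.ne', mul_zero] using h2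
  · intro h
    refine tendsto_of_tendsto_of_tendsto_of_le_of_le ?_ tendsto_const_nhds
      (fun n => le_condEntropyAt (q n) hs) (fun n => condEntropyAt_le p (q n) s)
    simpa using ((h.const_mul (p s).toReal).const_mul (1 - Real.log (p s).toReal)).const_sub
      (Real.negMulLog (p s).toReal)

/-! ### The chain rule -/

lemma ofReal_negMulLog_mul {a b : ℝ} (ha : 0 ≤ a) (ha1 : a ≤ 1) (hb : 0 ≤ b) (hb1 : b ≤ 1) :
    ENNReal.ofReal (Real.negMulLog (a * b)) =
      ENNReal.ofReal b * ENNReal.ofReal (Real.negMulLog a) +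
        ENNReal.ofReal a * ENNReal.ofReal (Real.negMulLog b) := by
  rw [Real.negMulLog_mul, ENNReal.ofReal_add (mul_nonneg hb (Real.negMulLog_nonneg ha ha1))
    (mul_nonneg ha (Real.negMulLog_nonneg hb hb1)), ENNReal.ofReal_mul hb, ENNReal.ofReal_mul ha]

lemma tsum_ofReal_posterior (p q : PMF G) {g : G} (hg : conv p q g ≠ 0) :
    ∑' s, ENNReal.ofReal (posterior p q s g) = 1 := by
  have h : ∀ s, ENNReal.ofReal (posterior p q s g) =
      p s * q (s⁻¹ * g) * (conv p q g)⁻¹ := by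
    intro s
    rw [posterior, ENNReal.ofReal_div_of_pos (ENNReal.toReal_pos hg (PMF.apply_ne_top _ _)),
      ENNReal.ofReal_mul ENNReal.toReal_nonneg, ENNReal.ofReal_toReal (PMF.apply_ne_top _ _),
      ENNReal.ofReal_toReal (PMF.apply_ne_top _ _), ENNReal.ofReal_toReal (PMF.apply_ne_top _ _),
      div_eq_mul_inv]
  simp only [h]
  rw [ENNReal.tsum_mul_right, ← conv_apply, ENNReal.mul_inv_cancel hg (PMF.apply_ne_top _ _)]

/-- Both sides compute the entropy of the pair (first factor, product): its mass factors either as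
p(s)·q(s⁻¹g) or as posterior times the law of the product. In `ENNReal` no finiteness is needed. -/
lemma entropy_add_entropy (p q : PMF G) :
    entropy p + entropy q =
      entropy (conv p q) + ∑' s, ENNReal.ofReal (condEntropyAt p q s) := by
  have hleft : ∑' s, ∑' g, ENNReal.ofReal
      (Real.negMulLog ((p s).toReal * (q (s⁻¹ * g)).toReal)) = entropy p + entropy q := by
    have h : ∀ s, ∑' g, ENNReal.ofReal
        (Real.negMulLog ((p s).toReal * (q (s⁻¹ * g)).toReal)) =
        ENNReal.ofReal (Real.negMulLog (p s).toReal) + p s * entropy q := by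
      intro s
      refine ((Equiv.mulLeft s⁻¹).tsum_eq fun g => ENNReal.ofReal
        (Real.negMulLog ((p s).toReal * (q g).toReal))).trans ?_
      simp only [ofReal_negMulLog_mul ENNReal.toReal_nonneg (mass_le_one p s)
        ENNReal.toReal_nonneg (mass_le_one q _), ENNReal.ofReal_toReal (PMF.apply_ne_top _ _)]
      rw [ENNReal.tsum_add, ENNReal.tsum_mul_right, ENNReal.tsum_mul_left, q.tsum_coe, one_mul,
        entropy]
    simp only [h]
    rw [ENNReal.tsum_add, ENNReal.tsum_mul_right, p.tsum_coe, one_mul, ← entropy]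
  have hright : ∑' s, ∑' g, ENNReal.ofReal
      (Real.negMulLog ((p s).toReal * (q (s⁻¹ * g)).toReal)) =
      entropy (conv p q) + ∑' s, ENNReal.ofReal (condEntropyAt p q s) := by
    have h : ∀ g, ∑' s, ENNReal.ofReal
        (Real.negMulLog ((p s).toReal * (q (s⁻¹ * g)).toReal)) =
        ENNReal.ofReal (Real.negMulLog (conv p q g).toReal) +
          ∑' s, ENNReal.ofReal
            (Real.negMulLog (posterior p q s g) * (conv p q g).toReal) := by
      intro g
      simp only [← posterior_mul_mass, ofReal_negMulLog_mul (posterior_nonneg p q _ g)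
        (posterior_le_one p q _ g) ENNReal.toReal_nonneg (mass_le_one (conv p q) g)]
      rw [ENNReal.tsum_add, ENNReal.tsum_mul_right, add_comm]
      congr 1
      · by_cases hg : conv p q g = 0
        · simp [hg]
        · rw [tsum_ofReal_posterior p q hg, one_mul]
      · refine tsum_congr fun s => ?_
        rw [ENNReal.ofReal_mul (negMulLog_posterior_nonneg p q s g), mul_comm]
    rw [ENNReal.tsum_comm]
    simp only [h]
    rw [ENNReal.tsum_add, ENNReal.tsum_comm, entropy]
    congr 1
    refine tsum_congr fun s => ?_
    rw [condEntropyAt, ENNReal.ofReal_tsum_of_nonneg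
      (fun g => mul_nonneg (negMulLog_posterior_nonneg p q s g) ENNReal.toReal_nonneg)
      (summable_condEntropyAt p q s)]
  rw [← hleft, hright]

lemma entropy_adjoint (μ : PMF G) : entropy (adjoint μ) = entropy μ := by
  simp only [entropy, adjoint_apply]
  exact (Equiv.inv G).tsum_eq fun g => ENNReal.ofReal (Real.negMulLog (μ g).toReal)

lemma entropy_pure {α : Type*} (a : α) : entropy (PMF.pure a) = 0 := by
  refine ENNReal.tsum_eq_zero.2 fun b => ?_
  by_cases hb : b = a <;> simp [PMF.pure_apply, hb]

lemma entropy_convPow_ne_top {μ : PMF G} (h : entropy μ ≠ ⊤) (n : ℕ) :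
    entropy (convPow μ n) ≠ ⊤ := by
  induction n with
  | zero => simp [convPow, entropy_pure]
  | succ n ih =>
    refine ne_top_of_le_ne_top (ENNReal.add_ne_top.2 ⟨h, ih⟩) ?_
    rw [entropy_add_entropy, convPow]
    exact le_self_add

lemma summable_negMulLog_mass {α : Type*} {μ : PMF α} (h : entropy μ ≠ ⊤) :
    Summable fun s => Real.negMulLog (μ s).toReal := by
  refine (ENNReal.summable_toReal h).congr fun s => ENNReal.toReal_ofReal ?_
  exact Real.negMulLog_nonneg ENNReal.toReal_nonneg (mass_le_one μ s)

/-- Every term is at most its limit −p(s) log p(s), which is summable. So termwise convergence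
passes to the sum by domination, and conversely each nonnegative deficit is at most the total
deficit. -/
lemma tendsto_condEntropyAt_forall_iff {p : PMF G} (h : entropy p ≠ ⊤) (q : ℕ → PMF G) :
    (∀ s ∈ p.support, Tendsto (fun n => invDefect p (q n) s) atTop (𝓝 0)) ↔
      Tendsto (fun n => ∑' s, condEntropyAt p (q n) s) atTop
        (𝓝 (∑' s, Real.negMulLog (p s).toReal)) := by
  have hp := summable_negMulLog_mass h
  have hc : ∀ n, Summable fun s => condEntropyAt p (q n) s := fun n =>
    hp.of_nonneg_of_le (condEntropyAt_nonneg p (q n)) (condEntropyAt_le p (q n))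
  constructor
  · intro hs
    refine tendsto_tsum_of_dominated_convergence hp (fun s => ?_)
      (Filter.Eventually.of_forall fun n s => ?_)
    · by_cases hsp : s ∈ p.support
      · exact (tendsto_condEntropyAt_iff q hsp).2 (hs s hsp)
      · simp only [condEntropyAt_of_notMem _ hsp, tendsto_const_nhds]
    · rw [Real.norm_of_nonneg (condEntropyAt_nonneg p (q n) s)]
      exact condEntropyAt_le p (q n) s
  · intro ht s hsp
    refine (tendsto_condEntropyAt_iff q hsp).1 ?_
    have hD := ht.const_sub (∑' s, Real.negMulLog (p s).toReal)
    rw [sub_self] at hD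
    have hD' : Tendsto (fun n => Real.negMulLog (p s).toReal - condEntropyAt p (q n) s) atTop
        (𝓝 0) := by
      refine squeeze_zero (fun n => sub_nonneg.2 (condEntropyAt_le p (q n) s)) (fun n => ?_) hD
      rw [← hp.tsum_sub (hc n)]
      exact (hp.sub (hc n)).le_tsum s fun t _ => sub_nonneg.2 (condEntropyAt_le p (q n) t)
    simpa using hD'.const_sub (Real.negMulLog (p s).toReal)

lemma tsum_condEntropyAt_adjoint {p : PMF G} (h : entropy p ≠ ⊤) (n : ℕ) :
    ∑' s, condEntropyAt (adjoint p) (convPow (adjoint p) n) s =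
      ∑' s, condEntropyAt p (convPow p n) s := by
  have h1 := entropy_add_entropy p (convPow p n)
  have h2 := entropy_add_entropy (adjoint p) (convPow (adjoint p) n)
  have h3 : entropy (conv (adjoint p) (convPow (adjoint p) n)) = entropy (conv p (convPow p n)) :=
    (congrArg entropy (convPow_adjoint p (n + 1))).trans (entropy_adjoint _)
  rw [h3, convPow_adjoint, entropy_adjoint, entropy_adjoint, h1, ← convPow_adjoint] at h2
  -- Finite entropy is essential here: it allows H(p^{*(n+1)}) to be cancelled.
  have h4 := (ENNReal.add_right_inj (entropy_convPow_ne_top h (n + 1))).1 h2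
  have h5 : ∀ r : PMF G, ∀ s, (ENNReal.ofReal (condEntropyAt r (convPow r n) s)).toReal =
      condEntropyAt r (convPow r n) s := fun r s =>
    ENNReal.toReal_ofReal (condEntropyAt_nonneg _ _ _)
  have h6 := congrArg ENNReal.toReal h4
  rw [ENNReal.tsum_toReal_eq fun _ => ENNReal.ofReal_ne_top,
    ENNReal.tsum_toReal_eq fun _ => ENNReal.ofReal_ne_top] at h6
  simp only [h5] at h6
  exact h6.symm

lemma closure_support_adjoint {μ : PMF G} (hμ : Subsemigroup.closure μ.support = ⊤) :
    Subsemigroup.closure (adjoint μ).support = ⊤ := by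
  have h : ∀ x ∈ Subsemigroup.closure μ.support,
      x⁻¹ ∈ Subsemigroup.closure (adjoint μ).support := by
    intro x hx
    induction hx using Subsemigroup.closure_induction with
    | mem x hx =>
      refine Subsemigroup.subset_closure ?_
      rw [PMF.mem_support_iff, adjoint_apply, inv_inv]
      exact (PMF.mem_support_iff _ _).1 hx
    | mul x y _ _ hx hy =>
      rw [mul_inv_rev]
      exact mul_mem hy hx
  refine eq_top_iff.2 fun x _ => ?_
  simpa using h x⁻¹ (hμ ▸ Subsemigroup.mem_top _)

lemma closure_support_lazy {μ : PMF G} (hμ : Subsemigroup.closure μ.support = ⊤) :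
    Subsemigroup.closure (lazy μ).support = ⊤ :=
  eq_top_iff.2 (hμ.ge.trans (Subsemigroup.closure_mono fun _ => mem_support_lazy))

theorem isLiouville_adjoint {μ : PMF G} (hμ : Subsemigroup.closure μ.support = ⊤)
    (hent : entropy (lazy μ) ≠ ⊤) (h : IsLiouville μ) : IsLiouville (adjoint μ) := by
  rw [← isLiouville_lazy_iff, ← adjoint_lazy]
  refine isLiouville_of_tendsto_invDefect (closure_support_adjoint (closure_support_lazy hμ)) ?_
  have h1 := (tendsto_condEntropyAt_forall_iff hent (convPow (lazy μ))).1
    fun s _ => tendsto_invDefect_of_isLiouville μ ((isLiouville_lazy_iff μ).2 h) s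
  refine (tendsto_condEntropyAt_forall_iff (by rwa [entropy_adjoint])
    (convPow (adjoint (lazy μ)))).2 ?_
  simp only [tsum_condEntropyAt_adjoint hent]
  -- Reindexing the limit by inversion turns H(p) into the entropy of the adjoint.
  rwa [← (Equiv.inv G).tsum_eq] at h1

/-! ### A finite first moment implies finite entropy -/

lemma exists_mem_pow {S : Set G} (hS : IsFiniteSymmGenerating S) (s : G) : ∃ n : ℕ, s ∈ S ^ n := by
  have hs : s ∈ Subgroup.closure S := hS.closure_eq ▸ Subgroup.mem_top s
  induction hs using Subgroup.closure_induction with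
  | mem x hx => exact ⟨1, by simpa using hx⟩
  | one => exact ⟨0, by simp⟩
  | mul x y _ _ hx hy =>
    obtain ⟨m, hm⟩ := hx
    obtain ⟨n, hn⟩ := hy
    exact ⟨m + n, by rw [pow_add]; exact Set.mul_mem_mul hm hn⟩
  | inv x _ hx =>
    obtain ⟨n, hn⟩ := hx
    refine ⟨n, ?_⟩
    rw [← hS.inv_eq, inv_pow]
    exact Set.inv_mem_inv.2 hn

lemma mem_pow_wordNorm {S : Set G} (hS : IsFiniteSymmGenerating S) (s : G) :
    s ∈ S ^ wordNorm S s :=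
  Nat.sInf_mem (s := {n : ℕ | s ∈ S ^ n}) (exists_mem_pow hS s)

lemma wordNorm_one (S : Set G) : wordNorm S 1 = 0 :=
  Nat.sInf_eq_zero.2 (Or.inl (by simp))

/-- Since |Sⁿ| ≤ |S|ⁿ, the ratio 1/(2(|S|+1)) beats the growth of the group and leaves a geometric
series of ratio 1/2; the +1 keeps the ratio finite when S is empty. -/
lemma tsum_pow_wordNorm_ne_top {S : Set G} (hS : IsFiniteSymmGenerating S) :
    ∑' s, ((2 * ((hS.finite.toFinset.card : ENNReal) + 1))⁻¹) ^ wordNorm S s ≠ ⊤ := by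
  classical
  set F := hS.finite.toFinset with hF
  set c : ENNReal := (F.card : ENNReal) with hc
  set x : ENNReal := (2 * (c + 1))⁻¹ with hx
  have hcx : c * x ≤ 2⁻¹ := by
    rw [hx, ENNReal.mul_inv (Or.inl (by simp)) (Or.inl (by simp)), mul_left_comm]
    refine mul_le_of_le_one_right' ?_
    rw [← div_eq_mul_inv]
    exact ENNReal.div_le_of_le_mul (by simp)
  have hmem : ∀ s, s ∈ F ^ wordNorm S s := by
    intro s
    rw [← Finset.mem_coe, Finset.coe_pow, hF, Set.Finite.coe_toFinset]
    exact mem_pow_wordNorm hS s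
  have h1 : ∀ s, x ^ wordNorm S s ≤ ∑' n : ℕ, if s ∈ F ^ n then x ^ n else 0 := by
    intro s
    refine le_trans ?_ (ENNReal.le_tsum (wordNorm S s))
    rw [if_pos (hmem s)]
  have h2 : ∀ n : ℕ, (∑' s, if s ∈ F ^ n then x ^ n else 0) ≤ 2⁻¹ ^ n := by
    intro n
    rw [tsum_eq_sum (s := F ^ n) fun s hs => if_neg hs,
      Finset.sum_congr rfl fun s hs => if_pos hs, Finset.sum_const, nsmul_eq_mul]
    calc ((F ^ n).card : ENNReal) * x ^ n ≤ c ^ n * x ^ n :=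
          mul_le_mul_left (by rw [hc]; exact_mod_cast Finset.card_pow_le) _
      _ = (c * x) ^ n := (mul_pow _ _ _).symm
      _ ≤ 2⁻¹ ^ n := pow_le_pow_left₀ zero_le hcx n
  refine ne_top_of_le_ne_top (b := ∑' n : ℕ, (2⁻¹ : ENNReal) ^ n) ?_ ?_
  · rw [ENNReal.tsum_geometric, ENNReal.one_sub_inv_two]
    simp
  · calc ∑' s, x ^ wordNorm S s ≤ ∑' s, ∑' n : ℕ, (if s ∈ F ^ n then x ^ n else 0) :=
          ENNReal.tsum_le_tsum h1
      _ = ∑' n : ℕ, ∑' s, (if s ∈ F ^ n then x ^ n else 0) := ENNReal.tsum_comm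
      _ ≤ _ := ENNReal.tsum_le_tsum h2

/-- Gibbs' inequality against a reference weight w. With w = k^(−ρ(s)), −log w is ρ(s) log k, so
entropy is controlled by the first moment. -/
lemma negMulLog_le_add {t w : ℝ} (ht : 0 ≤ t) (hw : 0 < w) :
    Real.negMulLog t ≤ t * -Real.log w + w := by
  rcases ht.eq_or_lt with rfl | ht0
  · simpa using hw.le
  have h := mul_le_mul_of_nonneg_left (Real.log_le_sub_one_of_pos (div_pos hw ht0)) ht
  rw [Real.log_div hw.ne' ht0.ne', show t * (w / t - 1) = w - t by field_simp] at h
  rw [Real.negMulLog]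
  linarith

lemma entropy_ne_top_of_summable_wordNorm {S : Set G} (hS : IsFiniteSymmGenerating S) (μ : PMF G)
    (hint : Summable fun s => (wordNorm S s : ℝ) * (μ s).toReal) : entropy μ ≠ ⊤ := by
  set k : ℝ := 2 * ((hS.finite.toFinset.card : ℝ) + 1) with hk
  have hk0 : 0 < k := by positivity
  have hw : Summable fun s => (k⁻¹) ^ wordNorm S s := by
    refine (ENNReal.summable_toReal (tsum_pow_wordNorm_ne_top hS)).congr fun s => ?_
    rw [ENNReal.toReal_pow, ENNReal.toReal_inv, ENNReal.toReal_mul,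
      ENNReal.toReal_add (by simp) (by simp), hk]
    simp
  have hsum : Summable fun s => Real.negMulLog (μ s).toReal := by
    refine Summable.of_nonneg_of_le
      (fun s => Real.negMulLog_nonneg ENNReal.toReal_nonneg (mass_le_one μ s)) (fun s => ?_)
      ((hint.mul_left (Real.log k)).add hw)
    refine (negMulLog_le_add ENNReal.toReal_nonneg
      (pow_pos (inv_pos.2 hk0) (wordNorm S s))).trans_eq ?_
    rw [Real.log_pow, Real.log_inv]
    ring
  exact hsum.tsum_ofReal_ne_top

lemma summable_wordNorm_lazy {S : Set G} {μ : PMF G}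
    (hint : Summable fun s => (wordNorm S s : ℝ) * (μ s).toReal) :
    Summable fun s => (wordNorm S s : ℝ) * (lazy μ s).toReal := by
  refine (hint.mul_left 2⁻¹).congr fun s => ?_
  rw [mass_lazy]
  by_cases hs : s = 1
  · simp [hs, wordNorm_one]
  · simp only [PMF.pure_apply, if_neg hs, ENNReal.toReal_zero, mul_zero, zero_add]
    ring

end MeasuredGroup

end

theorem mainTheorem2 {G : Type*} [Group G] (μ : PMF G)
    (hμ : MeasuredGroup.IsMeasuredGroup μ)
    (S : Set G) (hS : MeasuredGroup.IsFiniteSymmGenerating S)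
    (hint : Summable fun s : G => (MeasuredGroup.wordNorm S s : ℝ) * (μ s).toReal) :
    MeasuredGroup.IsLiouville μ ↔ MeasuredGroup.IsLiouville (MeasuredGroup.adjoint μ) := by
  have hent := MeasuredGroup.entropy_ne_top_of_summable_wordNorm hS (MeasuredGroup.lazy μ)
    (MeasuredGroup.summable_wordNorm_lazy hint)
  refine ⟨MeasuredGroup.isLiouville_adjoint hμ.closure_support hent, fun h => ?_⟩
  rw [← MeasuredGroup.adjoint_adjoint μ]
  refine MeasuredGroup.isLiouville_adjoint
    (MeasuredGroup.closure_support_adjoint hμ.closure_support) ?_ h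
  rwa [← MeasuredGroup.adjoint_lazy, MeasuredGroup.entropy_adjoint]
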